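/- Let $\Omega\subset\mathbb R^3$ be an open set (for example a bounded contractible Lipschitz domain), and write $(\cdot,\cdot)$ for the $L^2(\Omega)$ inner product. Let $H_0(\mathrm{curl},\Omega)$ and $H_0(\mathrm{grad},\Omega)=H^1_0(\Omega)$ be the closures of the smooth compactly supported fields, respectively functions, on $\Omega$ in the graph norms of $\mathrm{curl}$ and $\mathrm{grad}$; for Lipschitz $\Omega$ these are the spaces with vanishing trace $v\times n=0$, respectively $q=0$, on $\partial\Omega$. Let $H_0^h(\mathrm{curl})\subset H_0(\mathrm{curl},\Omega)$ and $H_0^h(\mathrm{grad})\subset H_0(\mathrm{grad},\Omega)$ be conforming finite element spaces from a discrete de Rham sequence; all that is required of them is that they are finite-dimensional subspaces with $\nabla H_0^h(\mathrm{grad})\subset H_0^h(\mathrm{curl})$, and that the fields in $H_0^h(\mathrm{curl})$ are essentially bounded (as piecewise polynomials on a bounded domain are). Let $R_e\in(0,\infty]$, with $R_e^{-1}=0$ if $R_e=\infty$, let $\Delta t>0$ and $N\in\mathbb N$. Let $u^n,\omega^n\in H_0^h(\mathrm{curl})$ for $0\le n\le N$ and $p^{n+1/2}\in H_0^h(\mathrm{grad})$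 for $0\le n<N$. For a sequence $a^n$ put $D_t a=(a^{n+1}-a^n)/\Delta t$ and $a^{n+1/2}=(a^{n+1}+a^n)/2$. Suppose that for every $0\le n<N$, with $u=u^{n+1/2}$, $\omega=\omega^{n+1/2}$, $p=p^{n+1/2}$, and for all $v,\mu\in H_0^h(\mathrm{curl})$ and $q\in H_0^h(\mathrm{grad})$, $$(D_tu,v)-(u\times\omega,v)+R_e^{-1}(\nabla\times u,\nabla\times v)+(\nabla p,v)=0,$$ $$(\omega,\mu)-(\nabla\times u,\mu)=0,\qquad (u,\nabla q)=0,$$ and that the scheme is started with the discrete vorticity of $u^0$: $(\omega^0,\mu)=(\nabla\times u^0,\mu)$ for all $\mu\in H_0^h(\mathrm{curl})$. Then for every $0\le n<N$, with $u,\omega$ on the right denoting the midpoint values, $$\frac1{\Delta t}\left(\int_\Omega u^{n+1}\cdot\omega^{n+1}\,dx-\int_\Omega u^{n}\cdot\omega^{n}\,dx\right)=-2R_e^{-1}\int_\Omega(\nabla\times u)\cdot(\nabla\times\omega)\,dx .$$ In particular, if $R_e=\infty$, then $\int_\Omega u^n\cdot\omega^n\,dx=\int_\Omega u^0\cdot\omega^0\,dx$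 for all $0\le n\le N$. -/

import Mathlib

open MeasureTheory
open scoped ENNReal

noncomputable section

namespace HelicityFEM

/-- Three-dimensional Euclidean space. -/
abbrev E3 : Type := EuclideanSpace ℝ (Fin 3)

/-- The Lebesgue space of square-integrable vector fields on `Ω`; `inner ℝ u v` is
`(u, v) = ∫_Ω u · v dx`. -/
abbrev L2Vec (Ω : Set E3) : Type := Lp E3 2 (volume.restrict Ω)

/-- The Lebesgue space of square-integrable scalar functions on `Ω`. -/
abbrev L2Scal (Ω : Set E3) : Type := Lp ℝ 2 (volume.restrict Ω)

/-- The cross product on Euclidean three-space. -/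
def cross (a b : E3) : E3 := WithLp.toLp 2 (crossProduct (WithLp.ofLp a) (WithLp.ofLp b))

/-- The partial derivative `∂_j φ_i` at `x`. -/
def partialDeriv (φ : E3 → E3) (j i : Fin 3) (x : E3) : ℝ :=
  (fderiv ℝ φ x (EuclideanSpace.single j 1)) i

/-- The classical curl of a differentiable vector field. -/
def classicalCurl (φ : E3 → E3) (x : E3) : E3 :=
  !₂[partialDeriv φ 1 2 x - partialDeriv φ 2 1 x,
     partialDeriv φ 2 0 x - partialDeriv φ 0 2 x,
     partialDeriv φ 0 1 x - partialDeriv φ 1 0 x]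

/-- The classical divergence of a differentiable vector field. -/
def classicalDiv (φ : E3 → E3) (x : E3) : ℝ := ∑ i, partialDeriv φ i i x

/-- Smooth functions with compact support contained in `Ω`. -/
structure IsTest {F : Type} [NormedAddCommGroup F] [NormedSpace ℝ F]
    (Ω : Set E3) (φ : E3 → F) : Prop where
  smooth : ContDiff ℝ (⊤ : ℕ∞) φ
  compact : HasCompactSupport φ
  support : tsupport φ ⊆ Ω

/-- `w` is the distributional curl of `u` on `Ω`. -/
def IsWeakCurl (Ω : Set E3) (u w : L2Vec Ω) : Prop :=
  ∀ φ : E3 → E3, IsTest Ω φ →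
    ∫ x in Ω, inner ℝ (u x) (classicalCurl φ x) = ∫ x in Ω, inner ℝ (w x) (φ x)

/-- `g` is the distributional gradient of `p` on `Ω`. -/
def IsWeakGrad (Ω : Set E3) (p : L2Scal Ω) (g : L2Vec Ω) : Prop :=
  ∀ φ : E3 → E3, IsTest Ω φ →
    ∫ x in Ω, p x * classicalDiv φ x = -∫ x in Ω, inner ℝ (g x) (φ x)

/-- `u ∈ H(curl, Ω)`: the distributional curl of `u` is square-integrable. -/
def MemHcurl (Ω : Set E3) (u : L2Vec Ω) : Prop := ∃ w : L2Vec Ω, IsWeakCurl Ω u w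

/-- `p ∈ H(grad, Ω)`: the distributional gradient of `p` is square-integrable. -/
def MemHgrad (Ω : Set E3) (p : L2Scal Ω) : Prop := ∃ g : L2Vec Ω, IsWeakGrad Ω p g

open Classical in
/-- The curl `∇ × u` of a field `u ∈ H(curl, Ω)` (zero by convention outside `H(curl, Ω)`). -/
def curl (Ω : Set E3) (u : L2Vec Ω) : L2Vec Ω :=
  if h : MemHcurl Ω u then Classical.choose h else 0

open Classical in
/-- The gradient `∇ p` of `p ∈ H(grad, Ω)` (zero by convention outside `H(grad, Ω)`). -/
def grad (Ω : Set E3) (p : L2Scal Ω) : L2Vec Ω :=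
  if h : MemHgrad Ω p then Classical.choose h else 0

/-- `u ∈ H₀(curl, Ω)`: `u` lies in the closure of the smooth compactly supported fields in the
graph norm of `H(curl, Ω)` (for Lipschitz `Ω`: the tangential trace `u × n` vanishes). -/
def MemH0curl (Ω : Set E3) (u : L2Vec Ω) : Prop :=
  MemHcurl Ω u ∧ ∀ ε : ℝ≥0∞, 0 < ε → ∃ φ : E3 → E3, IsTest Ω φ ∧
    eLpNorm (fun x => u x - φ x) 2 (volume.restrict Ω) < ε ∧
    eLpNorm (fun x => curl Ω u x - classicalCurl φ x) 2 (volume.restrict Ω) < ε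

/-- `p ∈ H₀(grad, Ω) = H¹₀(Ω)`: `p` lies in the closure of the smooth compactly supported
functions in the norm of `H¹(Ω)` (for Lipschitz `Ω`: the trace of `p` vanishes). -/
def MemH0grad (Ω : Set E3) (p : L2Scal Ω) : Prop :=
  MemHgrad Ω p ∧ ∀ ε : ℝ≥0∞, 0 < ε → ∃ ψ : E3 → ℝ, IsTest Ω ψ ∧
    eLpNorm (fun x => p x - ψ x) 2 (volume.restrict Ω) < ε ∧
    eLpNorm (fun x => grad Ω p x - gradient ψ x) 2 (volume.restrict Ω) < ε

/-- `Vc = H₀ʰ(curl, Ω)` and `Vg = H₀ʰ(grad, Ω)` are conforming finite element spaces that fit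
into a discrete de Rham sequence: finite-dimensional subspaces of `H₀(curl, Ω)` and
`H₀(grad, Ω)` with `grad Vg ⊆ Vc`. As for piecewise polynomials on a bounded domain, the
fields in `Vc` are bounded, so that `(u × ω, v)` is an absolutely convergent integral. -/
structure IsConformingPair (Ω : Set E3) (Vc : Submodule ℝ (L2Vec Ω))
    (Vg : Submodule ℝ (L2Scal Ω)) : Prop where
  finite_curl : FiniteDimensional ℝ Vc
  finite_grad : FiniteDimensional ℝ Vg
  conforming_curl : ∀ v ∈ Vc, MemH0curl Ω v
  conforming_grad : ∀ q ∈ Vg, MemH0grad Ω q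
  grad_mem : ∀ q ∈ Vg, grad Ω q ∈ Vc
  bounded : ∀ v ∈ Vc, MemLp v ∞ (volume.restrict Ω)

/-- The value at the midpoint of the `n`-th time interval. -/
def mid {Ω : Set E3} (u : ℕ → L2Vec Ω) (n : ℕ) : L2Vec Ω := (1 / 2 : ℝ) • (u (n + 1) + u n)

/-- The difference quotient `D_t u = (u^{n+1} - u^n) / Δt`. -/
def Dt {Ω : Set E3} (dt : ℝ) (u : ℕ → L2Vec Ω) (n : ℕ) : L2Vec Ω := dt⁻¹ • (u (n + 1) - u n)

/-- `u^n`, `ω^n` (`0 ≤ n ≤ N`) and the midpoint pressures `p n` (`0 ≤ n < N`) solve `N` steps of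
the midpoint mixed finite element scheme with zero force and Reynolds number `Re ∈ (0, ∞]`
(`Re = ∞` is the ideal case, `Re⁻¹ = 0`). -/
structure IsSolution (Ω : Set E3) (Vc : Submodule ℝ (L2Vec Ω)) (Vg : Submodule ℝ (L2Scal Ω))
    (Re : ℝ≥0∞) (dt : ℝ) (N : ℕ) (u ω : ℕ → L2Vec Ω) (p : ℕ → L2Scal Ω) : Prop where
  u_mem : ∀ n ≤ N, u n ∈ Vc
  ω_mem : ∀ n ≤ N, ω n ∈ Vc
  p_mem : ∀ n < N, p n ∈ Vg
  /-- the initial vorticity is the `L²` projection of `∇ × u^0` onto `Vc` -/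
  initial : ∀ μ ∈ Vc, inner ℝ (ω 0) μ - inner ℝ (curl Ω (u 0)) μ = 0
  momentum : ∀ n < N, ∀ v ∈ Vc,
    inner ℝ (Dt dt u n) v
      - (∫ x in Ω, inner ℝ (cross (mid u n x) (mid ω n x)) (v x))
      + Re⁻¹.toReal * inner ℝ (curl Ω (mid u n)) (curl Ω v)
      + inner ℝ (grad Ω (p n)) v = 0
  vorticity : ∀ n < N, ∀ μ ∈ Vc,
    inner ℝ (mid ω n) μ - inner ℝ (curl Ω (mid u n)) μ = 0
  incompressible : ∀ n < N, ∀ q ∈ Vg, inner ℝ (mid u n) (grad Ω q) = 0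

/-- The fluid helicity `∫_Ω u · ω dx`. -/
def helicity {Ω : Set E3} (u ω : L2Vec Ω) : ℝ := ∫ x in Ω, inner ℝ (u x) (ω x)

end HelicityFEM

end

/-!
The scheme conserves helicity up to viscous dissipation because the curl is symmetric on
`H₀(curl, Ω)` (`inner_curl_left`) and the discrete vorticity `ω^n` is the `L²` projection of
`∇ × u^n` onto `Vc` at every time level (`IsSolution.inner_vorticity`). Together these give
`(u^n, ω^{n+1}) = (u^{n+1}, ω^n)`, so the increment of `(u, ω)` over a time step equals
`2 (u^{n+1} - u^n, ω^{n+1/2})` (`IsSolution.helicity_sub`). Testing the momentum equation with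
`v = ω^{n+1/2}` evaluates this product: the Lamb vector `u × ω` is pointwise orthogonal to `ω`,
and `(∇p, ω) = (∇p, ∇ × u) = (∇ × ∇p, u) = 0` since `∇p ∈ Vc`
(`IsSolution.inner_grad_vorticity`). Only the viscous term is left.

The curl of a field in `H(curl, Ω)` is a chosen distributional curl, so its linearity and
`∇ × ∇p = 0` rest on uniqueness (`IsWeakCurl.unique`), that is, on the fundamental lemma of the
calculus of variations, and on `div (curl φ) = 0` for test fields.
-/

namespace HelicityFEM

/-! ### Calculus of the classical curl -/

theorem partialDeriv_contDiff {φ : E3 → E3} (hφ : ContDiff ℝ (⊤ : ℕ∞) φ) (j i : Fin 3) :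
    ContDiff ℝ (⊤ : ℕ∞) (partialDeriv φ j i) := by
  have h1 : ContDiff ℝ (⊤ : ℕ∞) (fderiv ℝ φ) := hφ.fderiv_right (by simp)
  have h2 : ContDiff ℝ (⊤ : ℕ∞) (fun x => fderiv ℝ φ x (EuclideanSpace.single j 1)) :=
    h1.clm_apply contDiff_const
  exact contDiff_euclidean.1 h2 i

theorem classicalCurl_contDiff {φ : E3 → E3} (hφ : ContDiff ℝ (⊤ : ℕ∞) φ) :
    ContDiff ℝ (⊤ : ℕ∞) (classicalCurl φ) := by
  rw [contDiff_euclidean]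
  intro i
  fin_cases i <;>
    exact (partialDeriv_contDiff hφ _ _).sub (partialDeriv_contDiff hφ _ _)

theorem tsupport_classicalCurl_subset (φ : E3 → E3) : tsupport (classicalCurl φ) ⊆ tsupport φ := by
  refine closure_minimal (fun x hx => ?_) (isClosed_tsupport φ)
  by_contra hxφ
  have h0 : fderiv ℝ φ x = 0 := by
    by_contra hne
    exact hxφ (support_fderiv_subset ℝ hne)
  refine hx ?_
  ext i
  fin_cases i <;> simp [classicalCurl, partialDeriv, h0]

theorem IsTest.classicalCurl {Ω : Set E3} {φ : E3 → E3} (hφ : IsTest Ω φ) :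
    IsTest Ω (classicalCurl φ) where
  smooth := classicalCurl_contDiff hφ.smooth
  compact := hφ.compact.of_isClosed_subset (isClosed_tsupport _) (tsupport_classicalCurl_subset φ)
  support := (tsupport_classicalCurl_subset φ).trans hφ.support

theorem fderiv_partialDeriv_apply {φ : E3 → E3} (hφ : ContDiff ℝ (⊤ : ℕ∞) φ) (j i : Fin 3)
    (x y : E3) :
    fderiv ℝ (partialDeriv φ j i) x y =
      (fderiv ℝ (fderiv ℝ φ) x y (EuclideanSpace.single j 1)) i := by
  have h1 : DifferentiableAt ℝ (fderiv ℝ φ) x :=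
    ((hφ.fderiv_right (m := (⊤ : ℕ∞)) (by simp)).differentiable (by simp)) x
  have h2 : HasFDerivAt (partialDeriv φ j i)
      ((EuclideanSpace.proj i : E3 →L[ℝ] ℝ).comp
        ((ContinuousLinearMap.apply ℝ E3 (EuclideanSpace.single j (1 : ℝ))).comp
          (fderiv ℝ (fderiv ℝ φ) x))) x :=
    (EuclideanSpace.proj i : E3 →L[ℝ] ℝ).hasFDerivAt.comp x
      ((ContinuousLinearMap.apply ℝ E3 (EuclideanSpace.single j (1 : ℝ))).hasFDerivAt.comp x
        h1.hasFDerivAt)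
  rw [h2.fderiv]
  rfl

/-- The divergence of a classical curl vanishes, by the symmetry of second derivatives. -/
theorem classicalDiv_classicalCurl {φ : E3 → E3} (hφ : ContDiff ℝ (⊤ : ℕ∞) φ) (x : E3) :
    classicalDiv (classicalCurl φ) x = 0 := by
  have hsymm : IsSymmSndFDerivAt ℝ φ x := 
    hφ.contDiffAt.isSymmSndFDerivAt (by
      rw [minSmoothness_of_isRCLikeNormedField]
      exact WithTop.coe_le_coe.2 (le_top (a := (2 : ℕ∞))))
  have hcomp : ∀ i : Fin 3, partialDeriv (classicalCurl φ) i i x =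
      fderiv ℝ (fun y => classicalCurl φ y i) x (EuclideanSpace.single i 1) := by
    intro i
    have h1 : DifferentiableAt ℝ (classicalCurl φ) x :=
      ((classicalCurl_contDiff hφ).differentiable (by simp)) x
    have h2 : HasFDerivAt (fun y => classicalCurl φ y i)
        ((EuclideanSpace.proj i : E3 →L[ℝ] ℝ).comp (fderiv ℝ (classicalCurl φ) x)) x :=
      (EuclideanSpace.proj i : E3 →L[ℝ] ℝ).hasFDerivAt.comp x h1.hasFDerivAt
    rw [h2.fderiv]
    rfl
  have hd : ∀ j i, DifferentiableAt ℝ (partialDeriv φ j i) x := fun j i =>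
    ((partialDeriv_contDiff hφ j i).differentiable (by simp)) x
  have hsub : ∀ (j i j' i' : Fin 3) (y : E3),
      fderiv ℝ (fun y => partialDeriv φ j i y - partialDeriv φ j' i' y) x y =
      (fderiv ℝ (fderiv ℝ φ) x y (EuclideanSpace.single j 1)) i -
        (fderiv ℝ (fderiv ℝ φ) x y (EuclideanSpace.single j' 1)) i' := by
    intro j i j' i' y
    rw [fderiv_fun_sub (hd j i) (hd j' i'), sub_apply,
      fderiv_partialDeriv_apply hφ, fderiv_partialDeriv_apply hφ]
  have e0 : (fun y => classicalCurl φ y 0) =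
    fun y => partialDeriv φ 1 2 y - partialDeriv φ 2 1 y := rfl
  have e1 : (fun y => classicalCurl φ y 1) =
    fun y => partialDeriv φ 2 0 y - partialDeriv φ 0 2 y := rfl
  have e2 : (fun y => classicalCurl φ y 2) =
    fun y => partialDeriv φ 0 1 y - partialDeriv φ 1 0 y := rfl
  rw [classicalDiv, Fin.sum_univ_three, hcomp, hcomp, hcomp, e0, e1, e2, hsub, hsub, hsub,
    hsymm (EuclideanSpace.single 1 1) (EuclideanSpace.single 0 1),
    hsymm (EuclideanSpace.single 2 1) (EuclideanSpace.single 0 1),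
    hsymm (EuclideanSpace.single 2 1) (EuclideanSpace.single 1 1)]
  ring

theorem inner_cross_right_self (a b : E3) : inner ℝ (cross a b) b = 0 := by
  simp only [cross, PiLp.inner_apply, Fin.sum_univ_three, cross_apply, RCLike.inner_apply,
    conj_trivial]
  simp
  ring

/-! ### The distributional curl -/

theorem IsTest.memLp {Ω : Set E3} {φ : E3 → E3} (hφ : IsTest Ω φ) :
    MemLp φ 2 (volume.restrict Ω) :=
  (hφ.smooth.continuous.memLp_of_hasCompactSupport hφ.compact).restrict Ω

theorem IsTest.inner_toLp {Ω : Set E3} {φ : E3 → E3} (hφ : IsTest Ω φ) (u : L2Vec Ω) :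
    inner ℝ u hφ.memLp.toLp = ∫ x in Ω, inner ℝ (u x) (φ x) := by
  rw [L2.inner_def]
  refine integral_congr_ae ?_
  filter_upwards [hφ.memLp.coeFn_toLp] with x hx
  rw [hx]

theorem isWeakCurl_iff {Ω : Set E3} {u w : L2Vec Ω} :
    IsWeakCurl Ω u w ↔ ∀ (φ : E3 → E3) (hφ : IsTest Ω φ),
      inner ℝ u hφ.classicalCurl.memLp.toLp = inner ℝ w hφ.memLp.toLp := by
  refine forall₂_congr fun φ hφ => ?_
  rw [hφ.inner_toLp, hφ.classicalCurl.inner_toLp]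

theorem IsWeakCurl.add {Ω : Set E3} {u w u' w' : L2Vec Ω} (h : IsWeakCurl Ω u w)
    (h' : IsWeakCurl Ω u' w') : IsWeakCurl Ω (u + u') (w + w') := by
  rw [isWeakCurl_iff] at *
  intro φ hφ
  rw [inner_add_left, inner_add_left, h φ hφ, h' φ hφ]

theorem IsWeakCurl.smul {Ω : Set E3} {u w : L2Vec Ω} (h : IsWeakCurl Ω u w) (c : ℝ) :
    IsWeakCurl Ω (c • u) (c • w) := by
  rw [isWeakCurl_iff] at *
  intro φ hφ
  rw [real_inner_smul_left, real_inner_smul_left, h φ hφ]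

/-- The fundamental lemma of the calculus of variations for square-integrable vector fields. -/
theorem eq_zero_of_integral_inner_test {Ω : Set E3} (hΩ : IsOpen Ω) {w : L2Vec Ω}
    (h : ∀ φ : E3 → E3, IsTest Ω φ → ∫ x in Ω, inner ℝ (w x) (φ x) = 0) : w = 0 := by
  have hloc : LocallyIntegrableOn (w : E3 → E3) Ω volume :=
    locallyIntegrableOn_of_locallyIntegrable_restrict
      ((Lp.memLp w).locallyIntegrable (by norm_num))
  have hcoord : ∀ i : Fin 3, ∀ᵐ x, x ∈ Ω → w x i = 0 := by
    intro i
    refine hΩ.ae_eq_zero_of_integral_contDiff_smul_eq_zero (f := fun x => w x i) ?_ ?_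
    · intro x hx
      obtain ⟨s, hs, hint⟩ := hloc x hx
      exact ⟨s, hs, (EuclideanSpace.proj i : E3 →L[ℝ] ℝ).integrable_comp hint⟩
    · intro g hg hgc hgs
      have htest : IsTest Ω (fun x => g x • (EuclideanSpace.single i (1 : ℝ) : E3)) :=
        { smooth := hg.smul contDiff_const
          compact := hgc.smul_right
          support := (tsupport_smul_subset_left g _).trans hgs }
      have h0 := h _ htest
      -- the integrand `g wᵢ` vanishes outside `Ω`, since `g` does
      rw [← setIntegral_eq_integral_of_forall_compl_eq_zero (s := Ω), ← h0]
      · refine integral_congr_ae (Filter.Eventually.of_forall fun x => ?_)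
        simp [real_inner_smul_right, EuclideanSpace.inner_single_right]
      · intro x hx
        rw [image_eq_zero_of_notMem_tsupport fun hxg => hx (hgs hxg), zero_smul]
  rw [Lp.eq_zero_iff_ae_eq_zero, Filter.EventuallyEq, ae_restrict_iff' hΩ.measurableSet]
  filter_upwards [ae_all_iff.2 hcoord] with x hx hxΩ
  ext i
  exact hx i hxΩ

theorem IsWeakCurl.unique {Ω : Set E3} (hΩ : IsOpen Ω) {u w w' : L2Vec Ω}
    (h : IsWeakCurl Ω u w) (h' : IsWeakCurl Ω u w') : w = w' := by
  refine sub_eq_zero.1 (eq_zero_of_integral_inner_test hΩ fun φ hφ => ?_)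
  rw [← hφ.inner_toLp, inner_sub_left, ← isWeakCurl_iff.1 h φ hφ, ← isWeakCurl_iff.1 h' φ hφ,
    sub_self]

theorem MemHcurl.isWeakCurl_curl {Ω : Set E3} {u : L2Vec Ω} (h : MemHcurl Ω u) :
    IsWeakCurl Ω u (curl Ω u) := by
  rw [curl, dif_pos h]
  exact Classical.choose_spec h

theorem IsWeakCurl.curl_eq {Ω : Set E3} (hΩ : IsOpen Ω) {u w : L2Vec Ω}
    (h : IsWeakCurl Ω u w) : curl Ω u = w :=
  (MemHcurl.isWeakCurl_curl ⟨w, h⟩).unique hΩ h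

theorem curl_add {Ω : Set E3} (hΩ : IsOpen Ω) {u v : L2Vec Ω} (hu : MemHcurl Ω u)
    (hv : MemHcurl Ω v) : curl Ω (u + v) = curl Ω u + curl Ω v :=
  (hu.isWeakCurl_curl.add hv.isWeakCurl_curl).curl_eq hΩ

theorem curl_smul {Ω : Set E3} (hΩ : IsOpen Ω) {u : L2Vec Ω} (hu : MemHcurl Ω u) (c : ℝ) :
    curl Ω (c • u) = c • curl Ω u :=
  (hu.isWeakCurl_curl.smul c).curl_eq hΩ

/-- Gradients are curl-free: the weak formulation tests against `div (curl φ) = 0`. -/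
theorem curl_grad {Ω : Set E3} (hΩ : IsOpen Ω) {p : L2Scal Ω} (hp : MemHgrad Ω p) :
    curl Ω (grad Ω p) = 0 := by
  have hg : IsWeakGrad Ω p (grad Ω p) := by
    rw [grad, dif_pos hp]
    exact Classical.choose_spec hp
  refine IsWeakCurl.curl_eq hΩ (isWeakCurl_iff.2 fun φ hφ => ?_)
  have h := hg _ hφ.classicalCurl
  simp only [classicalDiv_classicalCurl hφ.smooth, mul_zero, integral_zero] at h
  rw [hφ.classicalCurl.inner_toLp, inner_zero_left]
  linarith

theorem IsTest.norm_sub_toLp_lt {Ω : Set E3} {φ : E3 → E3} (hφ : IsTest Ω φ) {u : L2Vec Ω}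
    {ε : ℝ} (h : eLpNorm (fun x => u x - φ x) 2 (volume.restrict Ω) < ENNReal.ofReal ε) :
    ‖u - hφ.memLp.toLp‖ < ε := by
  have hae : (u - hφ.memLp.toLp : L2Vec Ω) =ᵐ[volume.restrict Ω] fun x => u x - φ x := by
    filter_upwards [Lp.coeFn_sub u hφ.memLp.toLp, hφ.memLp.coeFn_toLp] with x h1 h2
    rw [h1, Pi.sub_apply, h2]
  rw [Lp.norm_def, eLpNorm_congr_ae hae]
  exact ENNReal.toReal_lt_of_lt_ofReal h

/-- The curl is symmetric between `H₀(curl, Ω)` and `H(curl, Ω)`: for test fields this is the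
definition of the weak curl, and test fields are dense in `H₀(curl, Ω)`. -/
theorem inner_curl_left {Ω : Set E3} {u v : L2Vec Ω} (hu : MemH0curl Ω u)
    (hv : MemHcurl Ω v) : inner ℝ (curl Ω u) v = inner ℝ u (curl Ω v) := by
  refine sub_eq_zero.1 (abs_nonpos_iff.1 (le_of_forall_pos_le_add fun δ hδ => ?_))
  -- chosen so that `ε (‖v‖ + ‖curl v‖) ≤ δ`
  set ε : ℝ := δ / (‖v‖ + ‖curl Ω v‖ + 1) with hε
  have hεpos : 0 < ε := by positivity
  obtain ⟨φ, hφ, h1, h2⟩ := hu.2 (ENNReal.ofReal ε) (ENNReal.ofReal_pos.2 hεpos)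
  have h1 := (hφ.norm_sub_toLp_lt h1).le
  have h2 := (hφ.classicalCurl.norm_sub_toLp_lt h2).le
  have hφv := isWeakCurl_iff.1 hv.isWeakCurl_curl φ hφ
  have hsplit : inner ℝ (curl Ω u) v - inner ℝ u (curl Ω v) =
      inner ℝ (curl Ω u - hφ.classicalCurl.memLp.toLp) v
        - inner ℝ (u - hφ.memLp.toLp) (curl Ω v) := by
    rw [inner_sub_left, inner_sub_left, ← hφv.trans (real_inner_comm _ _),
      real_inner_comm v hφ.classicalCurl.memLp.toLp]
    ring
  have hb1 := (abs_real_inner_le_norm (curl Ω u - hφ.classicalCurl.memLp.toLp) v).trans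
    (mul_le_mul_of_nonneg_right h2 (norm_nonneg v))
  have hb2 := (abs_real_inner_le_norm (u - hφ.memLp.toLp) (curl Ω v)).trans
    (mul_le_mul_of_nonneg_right h1 (norm_nonneg _))
  have hδε : ε * (‖v‖ + ‖curl Ω v‖ + 1) = δ := div_mul_cancel₀ _ (by positivity)
  rw [hsplit]
  have := abs_sub (inner ℝ (curl Ω u - hφ.classicalCurl.memLp.toLp) v)
    (inner ℝ (u - hφ.memLp.toLp) (curl Ω v))
  nlinarith

/-! ### Conservation of helicity -/

theorem helicity_eq_inner {Ω : Set E3} (u ω : L2Vec Ω) : helicity u ω = inner ℝ u ω :=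
  (L2.inner_def u ω).symm

theorem integral_inner_cross_self {Ω : Set E3} (u ω : L2Vec Ω) :
    ∫ x in Ω, inner ℝ (cross (u x) (ω x)) (ω x) = 0 := by
  simp [inner_cross_right_self]

section Scheme

variable {Ω : Set E3} {Vc : Submodule ℝ (L2Vec Ω)} {Vg : Submodule ℝ (L2Scal Ω)} {Re : ℝ≥0∞}
  {dt : ℝ} {N : ℕ} {u ω : ℕ → L2Vec Ω} {p : ℕ → L2Scal Ω}

theorem mid_mem {a : ℕ → L2Vec Ω} (ha : ∀ n ≤ N, a n ∈ Vc) {n : ℕ} (hn : n < N) :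
    mid a n ∈ Vc :=
  Vc.smul_mem _ (Vc.add_mem (ha _ hn) (ha _ hn.le))

/-- The discrete vorticity is the `L²` projection of the curl of the discrete velocity at every
time level: the vorticity equation at the midpoints propagates this from the initial level. -/
theorem IsSolution.inner_vorticity (hΩ : IsOpen Ω) (hV : IsConformingPair Ω Vc Vg)
    (h : IsSolution Ω Vc Vg Re dt N u ω p) {n : ℕ} (hn : n ≤ N) {μ : L2Vec Ω} (hμ : μ ∈ Vc) :
    inner ℝ (ω n) μ = inner ℝ (curl Ω (u n)) μ := by
  induction n with
  | zero => exact sub_eq_zero.1 (h.initial μ hμ)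
  | succ n ih =>
    have hc : ∀ k ≤ N, MemHcurl Ω (u k) := fun k hk => (hV.conforming_curl _ (h.u_mem k hk)).1
    have hadd : MemHcurl Ω (u (n + 1) + u n) :=
      (hV.conforming_curl _ (Vc.add_mem (h.u_mem _ hn) (h.u_mem n (by omega)))).1
    have hv := h.vorticity n hn μ hμ
    rw [mid, mid, curl_smul hΩ hadd, curl_add hΩ (hc _ hn) (hc n (by omega)),
      real_inner_smul_left, real_inner_smul_left, inner_add_left, inner_add_left,
      ih (by omega)] at hv
    linarith

/-- The two halves of the discrete product rule for `(u, ω)` agree, because the symmetry of the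
curl gives `(u^n, ω^{n+1}) = (u^{n+1}, ω^n)`. -/
theorem IsSolution.helicity_sub (hΩ : IsOpen Ω) (hV : IsConformingPair Ω Vc Vg)
    (h : IsSolution Ω Vc Vg Re dt N u ω p) {n : ℕ} (hn : n < N) :
    helicity (u (n + 1)) (ω (n + 1)) - helicity (u n) (ω n) =
      2 * inner ℝ (u (n + 1) - u n) (mid ω n) := by
  have hu0 := h.u_mem n hn.le
  have hu1 := h.u_mem (n + 1) hn
  have hc0 := hV.conforming_curl _ hu0
  have hc1 := hV.conforming_curl _ hu1
  -- the vorticity at either level, tested with the velocity at the other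
  have h01 := h.inner_vorticity hΩ hV hn.le hu1
  have h10 := h.inner_vorticity hΩ hV hn hu0
  have hsymm : inner ℝ (curl Ω (u (n + 1))) (u n) = inner ℝ (u (n + 1)) (curl Ω (u n)) :=
    inner_curl_left hc1 hc0.1
  have hswap : (inner ℝ (u n) (ω (n + 1)) : ℝ) = inner ℝ (u (n + 1)) (ω n) := by
    rw [real_inner_comm, h10, hsymm, real_inner_comm, ← h01, real_inner_comm]
  simp only [helicity_eq_inner, mid, real_inner_smul_right, inner_add_right, inner_sub_left]
  linarith

/-- The discrete pressure gradient is orthogonal to the discrete vorticity, since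
`curl (grad p) = 0`. -/
theorem IsSolution.inner_grad_vorticity (hΩ : IsOpen Ω) (hV : IsConformingPair Ω Vc Vg)
    (h : IsSolution Ω Vc Vg Re dt N u ω p) {n : ℕ} (hn : n < N) :
    inner ℝ (grad Ω (p n)) (mid ω n) = 0 := by
  have hp := h.p_mem n hn
  have hg := hV.grad_mem _ hp
  rw [real_inner_comm, sub_eq_zero.1 (h.vorticity n hn _ hg),
    inner_curl_left (hV.conforming_curl _ (mid_mem h.u_mem hn)) (hV.conforming_curl _ hg).1,
    curl_grad hΩ (hV.conforming_grad _ hp).1, inner_zero_right]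

theorem IsSolution.helicity_balance (hΩ : IsOpen Ω) (hV : IsConformingPair Ω Vc Vg)
    (h : IsSolution Ω Vc Vg Re dt N u ω p) {n : ℕ} (hn : n < N) :
    (helicity (u (n + 1)) (ω (n + 1)) - helicity (u n) (ω n)) / dt =
      -2 * Re⁻¹.toReal * inner ℝ (curl Ω (mid u n)) (curl Ω (mid ω n)) := by
  have hm := h.momentum n hn _ (mid_mem h.ω_mem hn)
  rw [integral_inner_cross_self, h.inner_grad_vorticity hΩ hV hn, Dt,
    real_inner_smul_left] at hm
  rw [h.helicity_sub hΩ hV hn, div_eq_inv_mul]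
  linarith

end Scheme

end HelicityFEM

theorem mainTheorem2 (Ω : Set HelicityFEM.E3) (hΩ : IsOpen Ω)
    (Vc : Submodule ℝ (HelicityFEM.L2Vec Ω)) (Vg : Submodule ℝ (HelicityFEM.L2Scal Ω))
    (hV : HelicityFEM.IsConformingPair Ω Vc Vg)
    (Re : ℝ≥0∞) (hRe : 0 < Re) (dt : ℝ) (hdt : 0 < dt) (N : ℕ)
    (u ω : ℕ → HelicityFEM.L2Vec Ω) (p : ℕ → HelicityFEM.L2Scal Ω)
    (h : HelicityFEM.IsSolution Ω Vc Vg Re dt N u ω p) :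
    (∀ n < N,
      (HelicityFEM.helicity (u (n + 1)) (ω (n + 1)) - HelicityFEM.helicity (u n) (ω n)) / dt =
        -2 * Re⁻¹.toReal *
          ∫ x in Ω, inner ℝ (HelicityFEM.curl Ω (HelicityFEM.mid u n) x)
            (HelicityFEM.curl Ω (HelicityFEM.mid ω n) x)) ∧
    (Re = ∞ → ∀ n ≤ N, HelicityFEM.helicity (u n) (ω n) = HelicityFEM.helicity (u 0) (ω 0)) := by
  have hbal : ∀ n < N,
      (HelicityFEM.helicity (u (n + 1)) (ω (n + 1)) - HelicityFEM.helicity (u n) (ω n)) / dt =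
        -2 * Re⁻¹.toReal *
          inner ℝ (HelicityFEM.curl Ω (HelicityFEM.mid u n))
            (HelicityFEM.curl Ω (HelicityFEM.mid ω n)) :=
    fun n hn => h.helicity_balance hΩ hV hn
  refine ⟨fun n hn => (hbal n hn).trans (by rw [L2.inner_def]), fun hinf n hn => ?_⟩
  induction n with
  | zero => rfl
  | succ n ih =>
    have hb := hbal n hn
    rw [hinf, ENNReal.inv_top, ENNReal.toReal_zero, mul_zero, zero_mul, div_eq_zero_iff,
      or_iff_left hdt.ne', sub_eq_zero] at hb
    exact hb.trans (ih (by omega))
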